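/- A finite Blaschke product of degree $n \ge 0$ is a function $\Theta(z)=\lambda\prod_{j=1}^n \frac{z-a_j}{1-\overline{a_j}z}$ with $|\lambda|=1$ and $a_1,\dots,a_n$ in the open unit disk $\mathbb{D}$; it is called unicritical with zero $z_0\in\mathbb{D}$ if it equals $\lambda\left(\frac{z-z_0}{1-\overline{z_0}z}\right)^m$ for some $m\ge 1$ and $|\lambda|=1$. Let $H^2$ be the Hardy space of $\mathbb{D}$, i.e. the Hilbert space of power series $\sum_{k\ge0} c_k z^k$ with $\sum|c_k|^2<\infty$. For a finite Blaschke product $\Theta$ let $K_\Theta=H^2\ominus\Theta H^2$, let $P_\Theta$ be the orthogonal projection of $H^2$ onto $K_\Theta$, let $M_z$ be multiplication by $z$ on $H^2$, and let $S_\Theta=P_\Theta M_z|_{K_\Theta}$ be the compression of the shift, with numerical range $W(S_\Theta)=\{\langle S_\Theta f,f\rangle : f\in K_\Theta,\ \|f\|=1\}$. Let $\Theta$ and $B$ be finite Blaschke products with $\deg B<\deg\Theta$, and let $B$ be unicritical with zero $z_0$. Then $W(S_\Theta)\subseteq\mathbb{D}$, the function $|B|$ attains a maximum on $W(S_\Theta)$,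 and \[\max\{|B(z)| : z\in W(S_\Theta)\}\ \ge\ \tfrac12 .\] -/

import Mathlib

open scoped ComplexConjugate

noncomputable section

namespace LSC

/-- The Hardy space `H²` of the unit disk: power series `∑ aₙ zⁿ` with square-summable
coefficients, with inner product `∑ aₙ conj(bₙ)`. An element is stored through its sequence of
Taylor coefficients at `0`; its values on the disk are given by `H2.eval`. -/
abbrev H2 : Type := lp (fun _ : ℕ => ℂ) 2

/-- The value `f(z) = ∑ aₙ zⁿ` of `f ∈ H²` at a point `z` of the open unit disk. -/
def H2.eval (f : H2) (z : ℂ) : ℂ := ∑' n : ℕ, f n * z ^ n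

theorem H2.summable_eval (f : H2) {z : ℂ} (hz : z ∈ Metric.ball (0 : ℂ) 1) :
    Summable fun n : ℕ => f n * z ^ n := by
  have hz' : ‖z‖ < 1 := by simpa using hz
  refine Summable.of_norm_bounded
    ((summable_geometric_of_lt_one (norm_nonneg z) hz').mul_left ‖f‖) fun n => ?_
  rw [norm_mul, norm_pow]
  exact mul_le_mul_of_nonneg_right (lp.norm_apply_le_norm (by norm_num) f n) (by positivity)

theorem H2.eval_zero (z : ℂ) : H2.eval 0 z = 0 := by
  simp [H2.eval]

theorem H2.eval_add (f g : H2) {z : ℂ} (hz : z ∈ Metric.ball (0 : ℂ) 1) :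
    H2.eval (f + g) z = H2.eval f z + H2.eval g z := by
  unfold H2.eval
  rw [← (H2.summable_eval f hz).tsum_add (H2.summable_eval g hz)]
  simp [add_mul]

theorem H2.eval_smul (c : ℂ) (f : H2) (z : ℂ) :
    H2.eval (c • f) z = c * H2.eval f z := by
  unfold H2.eval
  rw [← tsum_mul_left]
  simp [mul_assoc]

/-- The Taylor coefficients of `z f(z)`. -/
def shiftSeq (a : ℕ → ℂ) : ℕ → ℂ
  | 0 => 0
  | n + 1 => a n

theorem hasSum_shiftSeq (f : H2) :
    HasSum (fun n => ‖shiftSeq f n‖ ^ (2 : ℝ)) (‖f‖ ^ (2 : ℝ)) := by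
  have h := lp.hasSum_norm (p := 2) (by norm_num) f
  have h2 : HasSum (fun n => ‖shiftSeq f (n + 1)‖ ^ (2 : ℝ)) (‖f‖ ^ (2 : ℝ)) := by
    simpa [shiftSeq] using h
  have h3 := (hasSum_nat_add_iff (f := fun n => ‖shiftSeq f n‖ ^ (2 : ℝ)) 1).1 h2
  simpa [shiftSeq] using h3

theorem memlp_shiftSeq (f : H2) : Memℓp (shiftSeq f) 2 :=
  (memℓp_gen_iff (by norm_num)).2 (by simpa using (hasSum_shiftSeq f).summable)

/-- The operator `M_z` on `H²` of multiplication by the independent variable,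
`(M_z f)(z) = z f(z)` (see `H2.eval_mulZ`). -/
def mulZ : H2 →L[ℂ] H2 :=
  LinearMap.mkContinuous
    { toFun := fun f => ⟨shiftSeq f, memlp_shiftSeq f⟩
      map_add' := fun f g => by
        ext n
        cases n with
        | zero => exact (add_zero (0 : ℂ)).symm
        | succ k => rfl
      map_smul' := fun c f => by
        ext n
        cases n <;> simp [shiftSeq] }
    1 fun f => by
      have h1 := lp.hasSum_norm (p := 2) (by norm_num) (⟨shiftSeq f, memlp_shiftSeq f⟩ : H2)
      have h2 := hasSum_shiftSeq f
      have h3 : ‖(⟨shiftSeq f, memlp_shiftSeq f⟩ : H2)‖ ^ (2 : ℝ) = ‖f‖ ^ (2 : ℝ) :=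
        HasSum.unique (by simpa using h1) h2
      have h4 : ‖(⟨shiftSeq f, memlp_shiftSeq f⟩ : H2)‖ = ‖f‖ :=
        (Real.rpow_left_inj (norm_nonneg _) (norm_nonneg _) (by norm_num)).1 h3
      simpa using h4.le

theorem H2.eval_mulZ (f : H2) {z : ℂ} (hz : z ∈ Metric.ball (0 : ℂ) 1) :
    H2.eval (mulZ f) z = z * H2.eval f z := by
  have h : ∀ n, (mulZ f) n = shiftSeq f n := fun n => rfl
  have hs := H2.summable_eval (mulZ f) hz
  unfold H2.eval
  rw [hs.tsum_eq_zero_add, ← tsum_mul_left]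
  simp only [h, shiftSeq, zero_mul, zero_add]
  exact tsum_congr fun n => by ring

/-- `Θ` is a finite Blaschke product of degree `n`: on the unit disk it is
`lam * ∏ (z - aⱼ) / (1 - conj aⱼ z)` with `|lam| = 1` and `a₁, …, aₙ` in the disk.
Only the values on the unit disk matter. -/
def IsFiniteBlaschke (Θ : ℂ → ℂ) (n : ℕ) : Prop :=
  ∃ (lam : ℂ) (a : Fin n → ℂ), ‖lam‖ = 1 ∧ (∀ j, ‖a j‖ < 1) ∧
    ∀ z ∈ Metric.ball (0 : ℂ) 1, Θ z = lam * ∏ j, (z - a j) / (1 - conj (a j) * z)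

/-- `B` is unicritical with zero `z₀`: on the unit disk it is
`lam * ((z - z₀) / (1 - conj z₀ z)) ^ m` for some `m ≥ 1` and `|lam| = 1`, where `|z₀| < 1`. -/
def IsUnicritical (B : ℂ → ℂ) (z₀ : ℂ) : Prop :=
  ‖z₀‖ < 1 ∧ ∃ (lam : ℂ) (m : ℕ), ‖lam‖ = 1 ∧ 1 ≤ m ∧
    ∀ z ∈ Metric.ball (0 : ℂ) 1, B z = lam * ((z - z₀) / (1 - conj z₀ * z)) ^ m

/-- The subspace `Θ H²` of `H²`: all `f ∈ H²` with `f = Θ g` on the disk for some `g ∈ H²`. -/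
def mulRange (Θ : ℂ → ℂ) : Submodule ℂ H2 where
  carrier := {f | ∃ g : H2, ∀ z ∈ Metric.ball (0 : ℂ) 1, H2.eval f z = Θ z * H2.eval g z}
  zero_mem' := ⟨0, fun z _ => by simp [H2.eval_zero]⟩
  add_mem' := by
    rintro f₁ f₂ ⟨g₁, h₁⟩ ⟨g₂, h₂⟩
    refine ⟨g₁ + g₂, fun z hz => ?_⟩
    rw [H2.eval_add _ _ hz, H2.eval_add _ _ hz, h₁ z hz, h₂ z hz]
    ring
  smul_mem' := by
    rintro c f ⟨g, h⟩
    refine ⟨c • g, fun z hz => ?_⟩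
    rw [H2.eval_smul, H2.eval_smul, h z hz]
    ring

/-- The model space `K_Θ = H² ⊖ Θ H²`. -/
abbrev modelSpace (Θ : ℂ → ℂ) : Submodule ℂ H2 := (mulRange Θ)ᗮ

/-- The compression of the shift `S_Θ = P_Θ M_z |_{K_Θ}`, with `P_Θ` the orthogonal projection of
`H²` onto `K_Θ`. -/
def compressedShift (Θ : ℂ → ℂ) : modelSpace Θ →L[ℂ] modelSpace Θ :=
  (modelSpace Θ).orthogonalProjectionOnto ∘L mulZ ∘L (modelSpace Θ).subtypeL

/-- The numerical range `W(T)`, the set of all `⟨T x, x⟩` with `‖x‖ = 1`. Mathlib's inner product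
is linear in its second argument. -/
def numericalRange {E : Type*} [NormedAddCommGroup E] [InnerProductSpace ℂ E] (T : E →L[ℂ] E) :
    Set ℂ :=
  {w | ∃ x : E, ‖x‖ = 1 ∧ inner ℂ x (T x) = w}

end LSC

end

/-! Write φ for the disk automorphism `(z - z₀) / (1 - conj z₀ z)`, so that `|B| = |φ| ^ k` on the
disk, and `A` for `S_Θ`. Two facts about `φ(A) ^ k` collide if the maximum is below 1/2.

Lower bound: since `k ≤ deg B < n`, the operator `φ(A) ^ k` preserves the norm of some nonzero
vector (`exists_norm_pow_eq`). Multiplication by `z` is isometric on `H²`, and on `1 / ∏ (1 - conj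
(a j) z)` polynomials of degree below `n` in `A` act as plain multiplication.

Upper bound: if `|φ| < ρ` on `W(A)`, then `W(A)` lies in a Euclidean disk; rescaling it to the unit
disk gives an operator `C` with `φ(A) = ρ ψ(C)` for another disk automorphism `ψ`. It remains to see
that `‖ψ(C) ^ k‖ ≤ 2` (`norm_moebius_pow_le`), whence `‖φ(A) ^ k‖ ≤ 2 ρ ^ k < 1` when `ρ ^ k < 1/2`.

For that, numerical radius at most one means `Re (1 - u C)⁻¹ ≥ 0` on the unit circle.
`ResolventBound` carries an extra scalar `β` recording the image of 0: it is stable under Möbius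
maps applied to operator and scalar together, and under powers, by averaging over roots of `u`. A
last Möbius map moves `β` back to 0, so `ψ(C) ^ k` is a Möbius function of some `G` of numerical
radius at most one. Such functions have norm at most 2, by `‖G y‖² + |⟨G y, y⟩|² ≤ 4` for unit `y`.
-/

open scoped ComplexConjugate

noncomputable section

namespace LSC

/-! ### Vector estimates for numerical radius at most one. -/

section NumericalRadius

variable {V : Type*} [NormedAddCommGroup V] [InnerProductSpace ℂ V]

/-- A vector estimate for operators of numerical radius at most one. -/
theorem norm_sq_add_inner_sq_le_of_nonneg (G : V →ₗ[ℂ] V)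
    (hG : ∀ y, ‖inner ℂ y (G y)‖ ≤ ‖y‖ ^ 2) (y : V) (hy : ‖y‖ = 1) (t : ℝ)
    (ht : inner ℂ y (G y) = (t : ℂ)) :
    ‖G y‖ ^ 2 + t ^ 2 ≤ 4 := by
  have key : ∀ (c : ℂ), ‖c‖ = 1 → ∀ y, (c * inner ℂ y (G y)).re ≤ ‖y‖ ^ 2 := fun c hc y =>
    (Complex.re_le_norm _).trans (by rw [norm_mul, hc, one_mul]; exact hG y)
  set z := G y - (t : ℂ) • y with hz
  have hyy : inner ℂ y y = (1 : ℂ) := by simp [inner_self_eq_norm_sq_to_K, hy]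
  have hyz : inner ℂ y z = (0 : ℂ) := by
    rw [hz, inner_sub_right, inner_smul_right, ht, hyy]; simp
  have hzy : inner ℂ z y = (0 : ℂ) := inner_eq_zero_symm.1 hyz
  have hGy : G y = z + (t : ℂ) • y := by simp [hz]
  have hzGy : inner ℂ z (G y) = ((‖z‖ ^ 2 : ℝ) : ℂ) := by
    rw [hGy, inner_add_right, inner_smul_right, hzy, inner_self_eq_norm_sq_to_K]; simp
  have hzz : inner ℂ z z = ((‖z‖ ^ 2 : ℝ) : ℂ) := by
    rw [inner_self_eq_norm_sq_to_K]; simp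
  have hnG : ‖G y‖ ^ 2 = ‖z‖ ^ 2 + t ^ 2 := by
    have : inner ℂ (G y) (G y) = ((‖z‖ ^ 2 + t ^ 2 : ℝ) : ℂ) := by
      conv_lhs => rw [hGy]
      simp only [inner_add_left, inner_add_right, inner_smul_left, inner_smul_right, hzz, hyz,
        hzy, hyy]
      simp; ring
    rw [inner_self_eq_norm_sq_to_K] at this
    exact Complex.ofReal_injective (by simpa using this)
  have hn : ∀ a b : ℂ, ‖a • y + b • z‖ ^ 2 = ‖a‖ ^ 2 + ‖b‖ ^ 2 * ‖z‖ ^ 2 := by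
    intro a b
    have : inner ℂ (a • y + b • z) (a • y + b • z)
        = ((‖a‖ ^ 2 + ‖b‖ ^ 2 * ‖z‖ ^ 2 : ℝ) : ℂ) := by
      simp only [inner_add_left, inner_add_right, inner_smul_left, inner_smul_right, hzz, hyz,
        hzy, hyy]
      push_cast
      rw [← Complex.conj_mul', ← Complex.conj_mul']
      ring
    rw [inner_self_eq_norm_sq_to_K] at this
    exact Complex.ofReal_injective (by simpa using this)
  have hq : ∀ a b : ℂ, inner ℂ (a • y + b • z) (G (a • y + b • z))
      = conj a * a * t + conj b * a * ((‖z‖ ^ 2 : ℝ) : ℂ) + conj a * b * inner ℂ y (G z)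
        + conj b * b * inner ℂ z (G z) := by
    intro a b
    simp only [map_add, map_smul, inner_add_left, inner_add_right, inner_smul_left,
      inner_smul_right, ht, hzGy]
    ring
  -- Opposite rotations cancel `r = ⟨z, G z⟩`: `h1 + h3` gives `2Z + 4 Re s ≤ 8 - 8t²` and `h2 + h4`
  -- gives `2Z - 4 Re s ≤ 8`, with `Z = ‖z‖²` and `s = ⟨y, G z⟩`. Their sum is `Z + 2t² ≤ 4`.
  have h1 := key 1 (by simp) (((2 * (1 + t) : ℝ) : ℂ) • y + (1 : ℂ) • z)
  have h2 := key (-Complex.I) (by simp) ((2 : ℂ) • y + (-Complex.I) • z)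
  have h3 := key (-1) (by simp) (((2 * (1 - t) : ℝ) : ℂ) • y + (-1 : ℂ) • z)
  have h4 := key Complex.I (by simp) ((2 : ℂ) • y + Complex.I • z)
  rw [hn, hq] at h1 h2 h3 h4
  simp only [Complex.norm_real, Real.norm_eq_abs, sq_abs] at h1 h3
  rw [hnG]
  generalize inner ℂ y (G z) = s at h1 h2 h3 h4
  generalize inner ℂ z (G z) = r at h1 h2 h3 h4
  generalize ‖z‖ ^ 2 = Z at h1 h2 h3 h4 ⊢
  simp at h1 h2 h3 h4
  nlinarith

theorem norm_sq_add_inner_sq_le (G : V →ₗ[ℂ] V)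
    (hG : ∀ y, ‖inner ℂ y (G y)‖ ≤ ‖y‖ ^ 2) (y : V) (hy : ‖y‖ = 1) :
    ‖G y‖ ^ 2 + ‖inner ℂ y (G y)‖ ^ 2 ≤ 4 := by
  obtain ⟨c, hc, hct⟩ : ∃ c : ℂ, ‖c‖ = 1 ∧ c * inner ℂ y (G y) = ‖inner ℂ y (G y)‖ := by
    by_cases h : inner ℂ y (G y) = 0
    · exact ⟨1, by simp, by simp [h]⟩
    · refine ⟨‖inner ℂ y (G y)‖ / inner ℂ y (G y), ?_, ?_⟩
      · rw [norm_div, Complex.norm_real, norm_norm, div_self (by simpa using h)]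
      · field_simp
  have := norm_sq_add_inner_sq_le_of_nonneg (c • G)
    (fun y => by simpa [inner_smul_right, hc] using hG y) y hy ‖inner ℂ y (G y)‖
    (by simpa [inner_smul_right] using hct)
  simpa [norm_smul, hc] using this

/-- This is `‖G y + β y‖² ≤ 4 ‖y + conj β G y‖²` for unit `y`, expanded with `a = ‖β‖`, `τ = |⟨G y,
y⟩|`, `g = ‖G y‖²` and the cross term replaced by its worst value `-aτ`. The coefficient of `g`
changes sign at `a = 1/2`, which decides whether the upper or the lower bound on `g` is used. -/
theorem scalar_moebius_estimate {a τ g : ℝ} (ha0 : 0 ≤ a) (ha : a ≤ 1) (hτ : 0 ≤ τ) (hτ1 : τ ≤ 1)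
    (hg : g + τ ^ 2 ≤ 4) (hτg : τ ^ 2 ≤ g) :
    6 * a * τ + (1 - 4 * a ^ 2) * g ≤ 4 - a ^ 2 := by
  rcases le_total a (1 / 2) with h | h
  · have h1 : (1 - 4 * a ^ 2) * g ≤ (1 - 4 * a ^ 2) * (4 - τ ^ 2) :=
      mul_le_mul_of_nonneg_left (by linarith) (by nlinarith)
    -- What remains is `(1 - 4a²)τ² - 6aτ + 15a² ≥ 0`. Its discriminant in `τ` is nonpositive for
    -- `a² ≤ 1/10`, in particular for `a ≤ 1/4`; beyond that `τ ≤ 1` is needed, and at `τ = 1` the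
    -- value is `11a² - 6a + 1`, smallest at `a = 3/11`.
    rcases le_total a (1 / 4) with h' | h'
    · have : (1 - 4 * a ^ 2) ≥ 3 / 4 := by nlinarith
      nlinarith [sq_nonneg (τ - 4 * a), mul_nonneg (sq_nonneg τ) (sub_nonneg.2 this),
        sq_nonneg a]
    · nlinarith [mul_nonneg (sub_nonneg.2 hτ1) (sub_nonneg.2 h'), mul_nonneg (sub_nonneg.2 hτ1)
        (mul_nonneg ha0 ha0), mul_nonneg (sub_nonneg.2 hτ1) (sub_nonneg.2 h),
        sq_nonneg (a - 3 / 11), mul_nonneg (mul_nonneg (sub_nonneg.2 hτ1) (sub_nonneg.2 h'))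
          (sub_nonneg.2 h), sq_nonneg (1 - τ)]
  · have h1 : (4 * a ^ 2 - 1) * τ ^ 2 ≤ (4 * a ^ 2 - 1) * g :=
      mul_le_mul_of_nonneg_left hτg (by nlinarith)
    nlinarith [mul_nonneg (sub_nonneg.2 hτ1) (sub_nonneg.2 ha), mul_nonneg (sub_nonneg.2 hτ1)
      (sub_nonneg.2 h), sq_nonneg (a - 1), sq_nonneg (1 - τ), mul_nonneg (sq_nonneg (1 - τ))
      (sub_nonneg.2 h), mul_nonneg (mul_nonneg (sub_nonneg.2 hτ1) (sub_nonneg.2 ha))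
          (sub_nonneg.2 h)]

theorem norm_moebius_le_two_mul (G : V →ₗ[ℂ] V)
    (hG : ∀ y, ‖inner ℂ y (G y)‖ ≤ ‖y‖ ^ 2) {β : ℂ} (hβ : ‖β‖ ≤ 1) (y : V) :
    ‖G y + β • y‖ ≤ 2 * ‖y + conj β • G y‖ := by
  have unit : ∀ y : V, ‖y‖ = 1 → ‖G y + β • y‖ ≤ 2 * ‖y + conj β • G y‖ := by
    intro y hy
    have h1 := norm_sq_add_inner_sq_le G hG y hy
    have h2 := hG y
    have h3 : ‖inner ℂ y (G y)‖ ≤ ‖G y‖ := by simpa [hy] using norm_inner_le_norm (𝕜 := ℂ) y (G y)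
    rw [hy, one_pow] at h2
    have h4 := scalar_moebius_estimate (norm_nonneg β) hβ (norm_nonneg (inner ℂ y (G y))) h2 h1
      (pow_le_pow_left₀ (norm_nonneg _) h3 2)
    refine le_of_sq_le_sq ?_ (by positivity) 
    have e1 : ‖G y + β • y‖ ^ 2
        = ‖G y‖ ^ 2 + 2 * (conj β * inner ℂ y (G y)).re + ‖β‖ ^ 2 := by
      rw [@norm_add_sq ℂ, inner_smul_right, norm_smul, hy, ← inner_conj_symm (G y) y]
      simp [-inner_conj_symm]
    have e2 : ‖y + conj β • G y‖ ^ 2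
        = 1 + 2 * (conj β * inner ℂ y (G y)).re + ‖β‖ ^ 2 * ‖G y‖ ^ 2 := by
      rw [@norm_add_sq ℂ, inner_smul_right, norm_smul, hy]
      simp [mul_pow]
    rw [mul_pow, e1, e2]
    have h5 : -(‖β‖ * ‖inner ℂ y (G y)‖) ≤ (conj β * inner ℂ y (G y)).re := by
      have := Complex.abs_re_le_norm (conj β * inner ℂ y (G y))
      rw [norm_mul, RCLike.norm_conj] at this
      exact neg_le_of_abs_le this
    nlinarith
  rcases eq_or_ne y 0 with rfl | hy
  · simp
  have h := unit (((‖y‖ : ℂ)⁻¹) • y) (by simp [norm_smul, hy])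
  rw [map_smul, smul_comm β, smul_comm (conj β), ← smul_add, ← smul_add, norm_smul, norm_smul,
    mul_left_comm] at h
  exact le_of_mul_le_mul_left h (by simpa using hy)

/-! ### Resolvent positivity under Möbius maps and powers. -/

/-- Positivity of the real part of `(1 - u X)⁻¹ + (1 - u β)⁻¹ - 1` on the unit circle, written
without inverting operators. -/
def ResolventBound (X : V →ₗ[ℂ] V) (β : ℂ) : Prop :=
  ∀ u : ℂ, ‖u‖ = 1 → ∀ z : V,
    (1 - ((1 - u * β)⁻¹).re) * ‖z - u • X z‖ ^ 2 ≤ (inner ℂ z (z - u • X z)).re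

theorem resolventBound_zero_iff (X : V →ₗ[ℂ] V) :
    ResolventBound X 0 ↔ ∀ y, ‖inner ℂ y (X y)‖ ≤ ‖y‖ ^ 2 := by
  have hre : ∀ (u : ℂ) (y : V), (inner ℂ y (y - u • X y)).re
      = ‖y‖ ^ 2 - (u * inner ℂ y (X y)).re := by
    intro u y
    rw [inner_sub_right, inner_smul_right, inner_self_eq_norm_sq_to_K, Complex.sub_re]
    norm_cast
  constructor
  · intro h y
    by_cases h0 : inner ℂ y (X y) = 0
    · simp [h0]
    have := h (‖inner ℂ y (X y)‖ / inner ℂ y (X y))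
      (by rw [norm_div, Complex.norm_real, norm_norm, div_self (by simpa using h0)]) y
    rw [hre, div_mul_cancel₀ _ h0] at this
    simpa using this
  · intro h u hu y
    rw [hre]
    have := (Complex.re_le_norm (u * inner ℂ y (X y))).trans_eq (norm_mul _ _)
    rw [hu, one_mul] at this
    have := h y
    simp only [mul_zero, sub_zero, inv_one, Complex.one_re, sub_self, zero_mul]
    linarith

theorem resolvent_coeff {β u : ℂ} (hu : ‖u‖ = 1) (hβ : ‖β‖ < 1) :
    1 + u * β ≠ 0 ∧ u + conj β ≠ 0 ∧ ‖(u + conj β) / (1 + u * β)‖ = 1 := by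
  have hne : 1 + u * β ≠ 0 := by
    intro h
    have : ‖u * β‖ = 1 := by rw [eq_neg_of_add_eq_zero_right h]; simp
    rw [norm_mul, hu] at this
    linarith
  have huu : conj u * u = 1 := by rw [Complex.conj_mul', hu]; simp
  have e : u + conj β = u * conj (1 + u * β) := by
    simp only [map_add, map_one, map_mul]; linear_combination (-conj β) * huu
  have hn : ‖u + conj β‖ = ‖1 + u * β‖ := by
    rw [e, norm_mul, RCLike.norm_conj, hu, one_mul]
  refine ⟨hne, fun h => hne (by rw [h] at hn; simpa using hn.symm), ?_⟩
  rw [norm_div, hn, div_self (by simpa using hne)]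

/-- Here `Y = (X - β)(1 - conj β X)⁻¹`. A Möbius map only reparametrises the resolvent: `1 - u Y` is
a multiple of `(1 - η X)(1 - conj β X)⁻¹`, where `η = (u + conj β) / (1 + u β)` is again unimodular.
-/
theorem inner_moebius_identity (X Y : V →ₗ[ℂ] V) {β u : ℂ} (hu : ‖u‖ = 1) (hβ : ‖β‖ < 1)
    (hY : ∀ y, Y (y - conj β • X y) = X y - β • y) (y : V) :
    let k := y - ((u + conj β) / (1 + u * β)) • X y
    let z := y - conj β • X y
    z - u • Y z = (1 + u * β) • k ∧
    (inner ℂ z (z - u • Y z)).re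
      = (1 - ‖β‖ ^ 2) * (inner ℂ y k).re + (‖β‖ ^ 2 + (u * β).re) * ‖k‖ ^ 2 := by
  intro k z
  obtain ⟨hne, hne', hη⟩ := resolvent_coeff hu hβ
  have huu : conj u * u = 1 := by rw [Complex.conj_mul', hu]; simp
  have hββ : conj β * β = (‖β‖ : ℂ) ^ 2 := Complex.conj_mul' β
  have h1 : z - u • Y z = (1 + u * β) • k := by
    simp only [z, k, hY, smul_sub, smul_smul, mul_div_cancel₀ _ hne]
    module
  refine ⟨h1, ?_⟩
  -- The factor `u + conj β` lets `X y` be eliminated in favour of `y` and `k`; being nonzero, it is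
  -- cancelled again in `h4`.
  have h2 : (u + conj β) • z = (u * (1 - ‖β‖ ^ 2 : ℝ)) • y + (conj β * (1 + u * β)) • k := by
    simp only [z, k, smul_sub, smul_smul, mul_assoc, mul_div_cancel₀ _ hne]
    push_cast
    rw [← hββ]
    module
  have h3 : inner ℂ ((u + conj β) • z) ((1 + u * β) • k)
      = conj (u + conj β) * (((1 - ‖β‖ ^ 2 : ℝ) : ℂ) * inner ℂ y k
          + (β * (u + conj β)) * ((‖k‖ ^ 2 : ℝ) : ℂ)) := by
    rw [h2, inner_add_left, inner_smul_left, inner_smul_left, inner_smul_right, inner_smul_right,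
      inner_self_eq_norm_sq_to_K]
    simp only [map_add, map_mul, map_one, Complex.conj_conj, Complex.conj_ofReal]
    push_cast
    linear_combination (((1 - (‖β‖ : ℂ) ^ 2) * inner ℂ y k * β) +
      (β ^ 2 * conj β - β) * (‖k‖ : ℂ) ^ 2) * huu
  rw [inner_smul_left, ← h1] at h3
  have h4 := mul_left_cancel₀ ((map_ne_zero _).2 hne') h3
  rw [h4]
  have : β * (u + conj β) = ((‖β‖ ^ 2 : ℝ) : ℂ) + u * β := by
    push_cast; rw [← hββ]; ring
  rw [this]
  simp only [Complex.add_re, Complex.re_ofReal_mul, Complex.re_mul_ofReal, Complex.ofReal_re]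

/-- The scalar follows the operator: the Möbius map sends 0 to `-β`. The coefficient of `‖k‖²` in
`inner_moebius_identity` matches the left side exactly, leaving a multiple of the bound for `X` at
`η`. -/
theorem ResolventBound.moebius_of_zero {X Y : V →ₗ[ℂ] V} {β : ℂ} (hX : ResolventBound X 0)
    (hβ : ‖β‖ < 1) (hsurj : Function.Surjective fun y => y - conj β • X y)
    (hY : ∀ y, Y (y - conj β • X y) = X y - β • y) :
    ResolventBound Y (-β) := by
  intro u hu z
  obtain ⟨y, rfl⟩ := hsurj z
  obtain ⟨h1, h2⟩ := inner_moebius_identity X Y hu hβ hY y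
  obtain ⟨hne, -, hη⟩ := resolvent_coeff hu hβ
  have h3 := hX _ hη y
  simp only at h1 h2 ⊢
  rw [h2, h1, norm_smul, mul_pow]
  set k := y - ((u + conj β) / (1 + u * β)) • X y
  simp only [mul_zero, sub_zero, inv_one, Complex.one_re, sub_self, zero_mul] at h3
  have h4 : (1 - ((1 - u * -β)⁻¹).re) * ‖1 + u * β‖ ^ 2 = ‖β‖ ^ 2 + (u * β).re := by
    rw [mul_neg, sub_neg_eq_add, Complex.inv_re, ← Complex.normSq_eq_norm_sq, sub_mul,
      div_mul_cancel₀ _ (by simpa using hne), Complex.normSq_add]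
    simp [Complex.normSq_eq_norm_sq, hu]
    ring
  rw [← mul_assoc, h4]
  have h5 : 0 ≤ 1 - ‖β‖ ^ 2 := by nlinarith [norm_nonneg β]
  linarith [mul_nonneg h5 h3]

theorem ResolventBound.moebius_to_zero {X Y : V →ₗ[ℂ] V} {β : ℂ} (hX : ResolventBound X β)
    (hβ : ‖β‖ < 1) (hsurj : Function.Surjective fun y => y - conj β • X y)
    (hY : ∀ y, Y (y - conj β • X y) = X y - β • y) :
    ResolventBound Y 0 := by
  intro u hu z
  obtain ⟨y, rfl⟩ := hsurj z
  obtain ⟨h1, h2⟩ := inner_moebius_identity X Y hu hβ hY y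
  obtain ⟨hne, -, hη⟩ := resolvent_coeff hu hβ
  have h3 := hX _ hη y
  simp only at h1 h2 ⊢
  rw [h2]
  set k := y - ((u + conj β) / (1 + u * β)) • X y
  have hpos : 0 < 1 - ‖β‖ ^ 2 := by nlinarith [norm_nonneg β]
  have h4 : (1 - (u + conj β) / (1 + u * β) * β)⁻¹ = (1 + u * β) / ((1 - ‖β‖ ^ 2 : ℝ) : ℂ) := by
    rw [div_mul_eq_mul_div, one_sub_div hne, inv_div]
    congr 1
    push_cast
    rw [← Complex.conj_mul']
    ring
  rw [h4, Complex.div_ofReal_re] at h3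
  have h5 := mul_le_mul_of_nonneg_left h3 hpos.le
  have h6 : (1 - ‖β‖ ^ 2) * ((1 - (1 + u * β).re / (1 - ‖β‖ ^ 2)) * ‖k‖ ^ 2)
      = -(‖β‖ ^ 2 + (u * β).re) * ‖k‖ ^ 2 := by
    rw [← mul_assoc, mul_sub, mul_div_cancel₀ _ hpos.ne']
    simp only [Complex.add_re, Complex.one_re]
    ring
  rw [h6] at h5
  simp only [mul_zero, sub_zero, inv_one, Complex.one_re, sub_self, zero_mul]
  linarith

theorem exists_roots_sum_pow_eq_zero {m : ℕ} (hm : m ≠ 0) (u : ℂ) :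
    ∃ ω : Fin m → ℂ, (∀ j, ω j ^ m = u) ∧
      ∀ k, k ≠ 0 → k < m → ∑ j, ω j ^ k = 0 := by
  obtain ⟨w, hw⟩ := IsAlgClosed.exists_pow_nat_eq u (Nat.pos_of_ne_zero hm)
  have hξ := Complex.isPrimitiveRoot_exp m hm
  set ξ := Complex.exp (2 * Real.pi * Complex.I / m)
  refine ⟨fun j => w * ξ ^ (j : ℕ), fun j => ?_, fun k hk hkm => ?_⟩
  · rw [mul_pow, hw, ← pow_mul, mul_comm (j : ℕ), pow_mul, hξ.pow_eq_one, one_pow, mul_one]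
  · have h1 : ξ ^ k ≠ 1 := hξ.pow_ne_one_of_pos_of_lt hk hkm
    simp only [mul_pow, ← pow_mul, mul_comm _ k]
    simp only [pow_mul]
    rw [← Finset.mul_sum, Fin.sum_univ_eq_sum_range fun j => (ξ ^ k) ^ j, geom_sum_eq h1,
      ← pow_mul, mul_comm k m, pow_mul, hξ.pow_eq_one]
    simp

/-- Averaging over the `m`-th roots of `u`: the partial sums `∑ k < m, ω ^ k X ^ k z` decompose
`m • z` into vectors mapped by `1 - ω X` to `(1 - u X ^ m) z`. -/
theorem exists_root_decomposition {W : Type*} [AddCommGroup W] [Module ℂ W] {m : ℕ} (hm : m ≠ 0)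
    {u : ℂ} {ω : Fin m → ℂ} (hω : ∀ j, ω j ^ m = u)
    (hsum : ∀ k, k ≠ 0 → k < m → ∑ j, ω j ^ k = 0) (X : W →ₗ[ℂ] W) (z : W) :
    ∃ zj : Fin m → W, (∀ j, zj j - ω j • X (zj j) = z - u • (X ^ m) z) ∧
      ∑ j, zj j = (m : ℂ) • z := by
  refine ⟨fun j => ∑ k ∈ Finset.range m, ω j ^ k • (X ^ k) z, fun j => ?_, ?_⟩
  · rw [map_sum, Finset.smul_sum, ← Finset.sum_sub_distrib]
    have : ∀ k ∈ Finset.range m, ω j ^ k • (X ^ k) z - ω j • X (ω j ^ k • (X ^ k) z)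
        = ω j ^ k • (X ^ k) z - ω j ^ (k + 1) • (X ^ (k + 1)) z := by
      intro k _
      rw [map_smul, smul_smul, ← pow_succ', pow_succ' X]
      rfl
    rw [Finset.sum_congr rfl this, Finset.sum_range_sub' fun k => ω j ^ k • (X ^ k) z, hω]
    simp
  · rw [Finset.sum_comm]
    simp only [← Finset.sum_smul]
    rw [Finset.sum_eq_single 0]
    · simp
    · intro k hk hk0
      rw [hsum k hk0 (Finset.mem_range.1 hk), zero_smul]
    · simp [Nat.pos_of_ne_zero hm]

theorem sum_inv_one_sub_roots {m : ℕ} (hm : m ≠ 0) {u β : ℂ} {ω : Fin m → ℂ}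
    (hu : 1 - u * β ^ m ≠ 0) (hω : ∀ j, ω j ^ m = u)
    (hsum : ∀ k, k ≠ 0 → k < m → ∑ j, ω j ^ k = 0) :
    ∑ j, (1 - ω j * β)⁻¹ = m * (1 - u * β ^ m)⁻¹ := by
  have h3 : ∀ j, (1 - ω j * β)⁻¹
      = (∑ k ∈ Finset.range m, (ω j * β) ^ k) * (1 - u * β ^ m)⁻¹ := by
    intro j
    have h := mul_neg_geom_sum (ω j * β) m
    rw [mul_pow, hω] at h
    have hne : 1 - ω j * β ≠ 0 := fun h0 => hu (by rw [← h, h0, zero_mul])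
    rw [eq_mul_inv_iff_mul_eq₀ hu, ← h, inv_mul_cancel_left₀ hne]
  rw [Finset.sum_congr rfl fun j _ => h3 j, ← Finset.sum_mul, Finset.sum_comm]
  congr 1
  simp only [mul_pow, ← Finset.sum_mul]
  rw [Finset.sum_eq_single 0]
  · simp
  · intro k hk hk0
    rw [hsum k hk0 (Finset.mem_range.1 hk), zero_mul]
  · simp [Nat.pos_of_ne_zero hm]

/-- The mean of `(1 - ω X)⁻¹` over the `m`-th roots `ω` of `u` is `(1 - u X ^ m)⁻¹`, and likewise
for the scalar `β`; so the bound for the power is the average of the bounds for `X` at the `ω`. -/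
theorem ResolventBound.pow {X : V →ₗ[ℂ] V} {β : ℂ} (hX : ResolventBound X β)
    (hβ : ‖β‖ < 1) {m : ℕ} (hm : m ≠ 0) : ResolventBound (X ^ m) (β ^ m) := by
  intro u hu z
  obtain ⟨ω, hω, hsum⟩ := exists_roots_sum_pow_eq_zero hm u
  obtain ⟨zj, h1, h2⟩ := exists_root_decomposition hm hω hsum X z
  have hω1 : ∀ j, ‖ω j‖ = 1 := fun j => by
    rw [← pow_eq_one_iff_of_nonneg (norm_nonneg _) hm, ← norm_pow, hω, hu]
  have hu0 : 1 - u * β ^ m ≠ 0 := by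
    intro h
    have : ‖u * β ^ m‖ = 1 := by rw [← sub_eq_zero.1 h]; simp
    rw [norm_mul, hu, one_mul, norm_pow] at this
    exact (pow_lt_one₀ (norm_nonneg _) hβ hm).ne this
  have h3 := Finset.sum_le_sum fun j (_ : j ∈ Finset.univ) => hX (ω j) (hω1 j) (zj j)
  simp only [h1] at h3
  rw [← Finset.sum_mul, Finset.sum_sub_distrib, ← Complex.re_sum, ← Complex.re_sum,
    sum_inv_one_sub_roots hm hu0 hω hsum, ← sum_inner, h2, inner_smul_left] at h3
  simp only [← Complex.ofReal_natCast, Complex.conj_ofReal, Complex.re_ofReal_mul] at h3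
  simp only [Finset.sum_const, Finset.card_univ, Fintype.card_fin, nsmul_eq_mul, mul_one] at h3
  have hm' : (0 : ℝ) < m := by exact_mod_cast Nat.pos_of_ne_zero hm
  refine le_of_mul_le_mul_left ?_ hm'
  linarith

/-- The Möbius map taking `β` to 0 turns `N` into an operator `G` of numerical radius at most one,
and `N = (G + β)(1 + conj β G)⁻¹` is covered by `norm_moebius_le_two_mul`. -/
theorem norm_le_two_mul_of_resolventBound [FiniteDimensional ℂ V] {N : V →ₗ[ℂ] V} {β : ℂ}
    (hN : ResolventBound N β) (hβ : ‖β‖ < 1) (hinj : ∀ z, z - conj β • N z = 0 → z = 0) (z : V) :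
    ‖N z‖ ≤ 2 * ‖z‖ := by
  set D : V →ₗ[ℂ] V := 1 - conj β • N with hD
  have hDk : D.ker = ⊥ := (LinearMap.ker_eq_bot').2 hinj
  obtain ⟨D', hD'⟩ := D.exists_leftInverse_of_injective hDk
  have hinv : ∀ y, D' (D y) = y := LinearMap.congr_fun hD'
  have hG0 := hN.moebius_to_zero (Y := (N - β • 1) ∘ₗ D') hβ
    (LinearMap.ker_eq_bot.1 hDk |> LinearMap.surjective_of_injective)
    (fun y => by
      have := hinv y
      simp only [hD, LinearMap.sub_apply, Module.End.one_apply, LinearMap.smul_apply] at this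
      simp [this])
  have h := norm_moebius_le_two_mul _ ((resolventBound_zero_iff _).1 hG0) hβ.le (D z)
  rw [LinearMap.comp_apply, hinv] at h
  have e1 : (N - β • 1) z + β • D z = ((1 - ‖β‖ ^ 2 : ℝ) : ℂ) • N z := by
    push_cast
    rw [← Complex.conj_mul']
    simp [hD]
    module
  have e2 : D z + conj β • (N - β • 1) z = ((1 - ‖β‖ ^ 2 : ℝ) : ℂ) • z := by
    push_cast
    rw [← Complex.conj_mul']
    simp [hD]
    module
  have hpos : 0 < 1 - ‖β‖ ^ 2 := by nlinarith [norm_nonneg β]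
  rw [e1, e2, norm_smul, norm_smul, mul_left_comm, Complex.norm_real] at h
  exact le_of_mul_le_mul_left h (by simpa using hpos.ne')

theorem norm_add_conj_le {α ω : ℂ} (hα : ‖α‖ < 1) (hω : ‖ω‖ ≤ 1) :
    1 + ω * α ≠ 0 ∧ ‖conj α + ω‖ ≤ ‖1 + ω * α‖ := by
  constructor
  · intro h
    have : ‖ω * α‖ = 1 := by rw [eq_neg_of_add_eq_zero_right h]; simp
    rw [norm_mul] at this
    nlinarith [norm_nonneg α, norm_nonneg ω]
  · refine le_of_sq_le_sq ?_ (norm_nonneg _)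
    have h1 : ‖α‖ ^ 2 ≤ 1 := by nlinarith [norm_nonneg α]
    have h2 : ‖ω‖ ^ 2 ≤ 1 := by nlinarith [norm_nonneg ω]
    rw [← Complex.normSq_eq_norm_sq] at h1 h2 ⊢
    rw [← Complex.normSq_eq_norm_sq]
    simp only [Complex.normSq_apply, Complex.add_re, Complex.add_im, Complex.mul_re,
      Complex.mul_im, Complex.conj_re, Complex.conj_im, Complex.one_re, Complex.one_im] at *
    nlinarith [mul_nonneg (sub_nonneg.2 h1) (sub_nonneg.2 h2)]

/-- If the numerical range of `C` lies in the open unit disk, then powers of a disk automorphism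
of `C` have norm at most two. -/
theorem norm_moebius_pow_le [FiniteDimensional ℂ V] (C : V →ₗ[ℂ] V)
    (hC : ∀ y, y ≠ 0 → ‖inner ℂ y (C y)‖ < ‖y‖ ^ 2) {α : ℂ} (hα : ‖α‖ < 1) {m : ℕ} (hm : m ≠ 0)
    (v : V) : ‖((C - α • 1) ^ m) v‖ ≤ 2 * ‖((1 - conj α • C) ^ m) v‖ := by
  have hC' : ∀ y, ‖inner ℂ y (C y)‖ ≤ ‖y‖ ^ 2 := fun y => by
    rcases eq_or_ne y 0 with rfl | hy
    · simp
    · exact (hC y hy).le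
  -- The strict inequality in `hC` makes `a - b C` injective whenever `‖b‖ ≤ ‖a‖` and `a ≠ 0`. All
  -- inverses needed below rest on this.
  have hinjC : ∀ (a b : ℂ) (y : V), a ≠ 0 → ‖b‖ ≤ ‖a‖ → a • y = b • C y → y = 0 := by
    intro a b y ha hab h
    by_contra hy
    have h1 : a * inner ℂ y y = b * inner ℂ y (C y) := by
      rw [← inner_smul_right, ← inner_smul_right, h]
    have h2 := congrArg norm h1
    rw [norm_mul, norm_mul, inner_self_eq_norm_sq_to_K] at h2
    simp only [norm_pow, RCLike.norm_ofReal, abs_norm] at h2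
    have h3 := hC y hy
    have h4 : 0 < ‖a‖ := norm_pos_iff.2 ha
    nlinarith [norm_nonneg (inner ℂ y (C y)), mul_lt_mul_of_pos_left h3 h4,
      mul_le_mul_of_nonneg_right hab (norm_nonneg (inner ℂ y (C y)))]
  set D : V →ₗ[ℂ] V := 1 - conj α • C with hD
  have hDk : D.ker = ⊥ := (LinearMap.ker_eq_bot').2 fun y hy =>
    hinjC 1 (conj α) y one_ne_zero (by simpa using hα.le) (by simpa [hD, sub_eq_zero] using hy)
  obtain ⟨D', hD'⟩ := D.exists_leftInverse_of_injective hDk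
  have hinv : ∀ y, D' (D y) = y := LinearMap.congr_fun hD'
  have hsurj : Function.Surjective D :=
    LinearMap.surjective_of_injective (LinearMap.ker_eq_bot.1 hDk)
  set E : V →ₗ[ℂ] V := (C - α • 1) * D' with hE
  have hED : ∀ y, E (D y) = (C - α • 1) y := fun y => by rw [hE, Module.End.mul_apply, hinv]
  have hEb : ResolventBound E (-α) :=
    ((resolventBound_zero_iff C).2 hC').moebius_of_zero hα hsurj hED
  have hinjE : ∀ ω : ℂ, ‖ω‖ ≤ 1 → ∀ z, z - ω • E z = 0 → z = 0 := by
    intro ω hω z hz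
    obtain ⟨y, rfl⟩ := hsurj z
    rw [hED] at hz
    obtain ⟨h1, h2⟩ := norm_add_conj_le hα hω
    rw [hinjC _ _ y h1 h2, map_zero]
    rw [← sub_eq_zero, ← hz]
    simp [hD]
    module
  -- The root decomposition writes `m z` as a sum of vectors killed by `1 - ω E`, each zero by
  -- `hinjE`.
  have hinjN : ∀ u : ℂ, ‖u‖ ≤ 1 → ∀ z, z - u • (E ^ m) z = 0 → z = 0 := by
    intro u hu z hz
    obtain ⟨ω, hω, hsum⟩ := exists_roots_sum_pow_eq_zero hm u
    obtain ⟨zj, h1, h2⟩ := exists_root_decomposition hm hω hsum E z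
    have hω1 : ∀ j, ‖ω j‖ ≤ 1 := fun j => by
      rw [← pow_le_one_iff_of_nonneg (norm_nonneg _) hm, ← norm_pow, hω]
      exact hu
    have h3 : ∀ j, zj j = 0 := fun j => hinjE _ (hω1 j) _ ((h1 j).trans hz)
    simp only [h3, Finset.sum_const_zero] at h2
    exact (smul_eq_zero.1 h2.symm).resolve_left (by exact_mod_cast hm)
  have hβ : ‖(-α) ^ m‖ < 1 := by
    rw [norm_pow, norm_neg]; exact pow_lt_one₀ (norm_nonneg _) hα hm
  have hfin := norm_le_two_mul_of_resolventBound (hEb.pow (by simpa using hα) hm) hβ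
    (hinjN _ (by simpa using hβ.le)) ((D ^ m) v)
  have hcomm : Commute E D := by
    have h1 : Commute (C - α • 1) D := by
      rw [hD]
      exact ((Commute.refl C).sub_left (((Commute.one_left C)).smul_left α)).smul_right _
        |> (Commute.one_right _).sub_right
    have h2 : Commute D' D := hD'.trans <| .symm <| LinearMap.ext fun z => by
      obtain ⟨y, rfl⟩ := hsurj z
      rw [Module.End.mul_apply, hinv]; rfl
    exact h1.mul_left h2
  have hprod : E * D = C - α • 1 := LinearMap.ext hED
  rwa [← Module.End.mul_apply, ← hcomm.mul_pow, hprod] at hfin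

/-! ### From pseudohyperbolic disks to the unit disk. -/

/-- A pseudohyperbolic disk is a Euclidean disk. -/
theorem norm_sub_center_lt {z₀ w : ℂ} {ρ : ℝ} (hz₀ : ‖z₀‖ < 1) (hρ : 0 < ρ) (hρ1 : ρ < 1)
    (h : ‖w - z₀‖ < ρ * ‖1 - conj z₀ * w‖) :
    ‖w - z₀ + ((1 - ‖z₀‖ ^ 2) / (1 - ρ ^ 2 * ‖z₀‖ ^ 2) * ρ ^ 2 : ℝ) * z₀‖
      < (1 - ‖z₀‖ ^ 2) / (1 - ρ ^ 2 * ‖z₀‖ ^ 2) * ρ := by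
  have h1 : ‖z₀‖ ^ 2 < 1 := by nlinarith [norm_nonneg z₀]
  have h2 : 0 < 1 - ρ ^ 2 * ‖z₀‖ ^ 2 := by nlinarith [sq_nonneg ‖z₀‖]
  have h3 := pow_lt_pow_left₀ h (norm_nonneg _) two_ne_zero
  have h4 : 0 ≤ (1 - ‖z₀‖ ^ 2) / (1 - ρ ^ 2 * ‖z₀‖ ^ 2) * ρ :=
    mul_nonneg (div_nonneg (by linarith) h2.le) hρ.le
  refine lt_of_pow_lt_pow_left₀ 2 h4 (lt_of_mul_lt_mul_left ?_ h2.le)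
  obtain ⟨κ, hκ⟩ : ∃ κ, κ = (1 - ‖z₀‖ ^ 2) / (1 - ρ ^ 2 * ‖z₀‖ ^ 2) := ⟨_, rfl⟩
  have hκ' : κ * (1 - ρ ^ 2 * ‖z₀‖ ^ 2) = 1 - ‖z₀‖ ^ 2 := by rw [hκ, div_mul_cancel₀ _ h2.ne']
  rw [← hκ]
  clear h4 hκ h
  rw [mul_pow] at h3
  rw [← Complex.normSq_eq_norm_sq, ← Complex.normSq_eq_norm_sq] at *
  simp only [Complex.normSq_apply, Complex.add_re, Complex.add_im, Complex.mul_re, Complex.sub_re,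
    Complex.sub_im, Complex.ofReal_re, Complex.ofReal_im,
    Complex.mul_im, Complex.conj_re, Complex.conj_im, Complex.one_re, Complex.one_im] at *
  generalize z₀.re = a at *
  generalize z₀.im = b at *
  generalize w.re = x at *
  generalize w.im = y at *
  have h5 : (1 - ρ ^ 2 * (a * a + b * b)) * ((x - a + (κ * ρ ^ 2 * a - 0 * b))
      * (x - a + (κ * ρ ^ 2 * a - 0 * b)) + (y - b + (κ * ρ ^ 2 * b + 0 * a))
      * (y - b + (κ * ρ ^ 2 * b + 0 * a))) - (1 - ρ ^ 2 * (a * a + b * b)) * (κ * ρ) ^ 2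
      = ((x - a) * (x - a) + (y - b) * (y - b)) - ρ ^ 2 * ((1 - (a * x - -b * y))
        * (1 - (a * x - -b * y)) + (0 - (a * y + -b * x)) * (0 - (a * y + -b * x))) := by
    linear_combination (2 * ρ ^ 2 * ((x - a) * a + (y - b) * b)
      + κ * ρ ^ 2 * (ρ ^ 2 * (a * a + b * b) - 1) - (1 - (a * a + b * b)) * ρ ^ 2) * hκ'
  linarith

/-- If the numerical range of `A` lies in a pseudohyperbolic disk of radius `ρ` around `z₀`, then
the `m`-th power of the corresponding disk automorphism of `A` has norm at most `2 ρ ^ m`. -/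
theorem norm_sub_pow_le [FiniteDimensional ℂ V] (A : V →ₗ[ℂ] V) {z₀ : ℂ} {ρ : ℝ}
    (hz₀ : ‖z₀‖ < 1) (hρ : 0 < ρ) (hρ1 : ρ < 1)
    (hA : ∀ y, ‖y‖ = 1 → ‖inner ℂ y (A y) - z₀‖ < ρ * ‖1 - conj z₀ * inner ℂ y (A y)‖)
    {m : ℕ} (hm : m ≠ 0) (v : V) :
    ‖((A - z₀ • 1) ^ m) v‖ ≤ 2 * ρ ^ m * ‖((1 - conj z₀ • A) ^ m) v‖ := by
  have h1 : ‖z₀‖ ^ 2 < 1 := by nlinarith [norm_nonneg z₀]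
  have h2 : 0 < 1 - ρ ^ 2 * ‖z₀‖ ^ 2 := by nlinarith [sq_nonneg ‖z₀‖]
  have hw := fun y hy => norm_sub_center_lt hz₀ hρ hρ1 (hA y hy)
  obtain ⟨κ, hκ⟩ : ∃ κ, κ = (1 - ‖z₀‖ ^ 2) / (1 - ρ ^ 2 * ‖z₀‖ ^ 2) := ⟨_, rfl⟩
  have hκ' : κ * (1 - ρ ^ 2 * ‖z₀‖ ^ 2) = 1 - ‖z₀‖ ^ 2 := by rw [hκ, div_mul_cancel₀ _ h2.ne']
  have hκ0 : 0 < κ := by rw [hκ]; exact div_pos (by linarith) h2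
  rw [← hκ] at hw
  have hr : 0 < κ * ρ := mul_pos hκ0 hρ
  have hrC : ((κ * ρ : ℝ) : ℂ) ≠ 0 := by exact_mod_cast hr.ne'
  -- `C` is `A` with the Euclidean disk of centre `(1 - κρ²) z₀` and radius `κρ` rescaled to the
  -- unit disk. The choice `α = ρ z₀` makes numerator and denominator transform by the factors `κρ`
  -- and `κ`, so exactly `ρ` is left in the quotient.
  set α : ℂ := ρ * z₀ with hα
  set C : V →ₗ[ℂ] V := ((κ * ρ : ℝ) : ℂ)⁻¹ • (A - z₀ • 1) + α • 1 with hC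
  have e1 : A - z₀ • 1 = ((κ * ρ : ℝ) : ℂ) • (C - α • 1) := by
    rw [hC, add_sub_cancel_right, smul_inv_smul₀ hrC]
  have e2 : 1 - conj z₀ • A = (κ : ℂ) • (1 - conj α • C) := by
    rw [sub_eq_iff_eq_add] at e1
    have : (κ : ℂ) * (1 - ρ ^ 2 * (conj z₀ * z₀)) = 1 - conj z₀ * z₀ := by
      rw [Complex.conj_mul']; exact_mod_cast hκ'
    rw [e1, hα]
    simp only [map_mul, Complex.conj_ofReal]
    push_cast
    rw [smul_sub (κ : ℂ), ← sub_eq_zero]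
    have h0 : (1 - conj z₀ * z₀ - (κ : ℂ) * (1 - ρ ^ 2 * (conj z₀ * z₀))) • (1 : V →ₗ[ℂ] V) = 0 := by
      rw [this, sub_self, zero_smul]
    rw [← h0]
    module
  have hαn : ‖α‖ < 1 := by
    rw [hα, norm_mul, Complex.norm_real, Real.norm_of_nonneg hρ.le]
    nlinarith [norm_nonneg z₀]
  have hCn : ∀ y, y ≠ 0 → ‖inner ℂ y (C y)‖ < ‖y‖ ^ 2 := by
    have unit : ∀ y, ‖y‖ = 1 → ‖inner ℂ y (C y)‖ < 1 := by
      intro y hy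
      have e : inner ℂ y (C y) = ((κ * ρ : ℝ) : ℂ)⁻¹ *
          (inner ℂ y (A y) - z₀ + ((κ * ρ ^ 2 : ℝ) : ℂ) * z₀) := by
        have hyy : inner ℂ y y = (1 : ℂ) := by simp [inner_self_eq_norm_sq_to_K, hy]
        simp only [hC, LinearMap.add_apply, LinearMap.smul_apply, LinearMap.sub_apply,
          Module.End.one_apply, inner_add_right, inner_smul_right, inner_sub_right, hyy, hα]
        field_simp
        push_cast
        ring
      rw [e, norm_mul, norm_inv, Complex.norm_real, Real.norm_of_nonneg hr.le,
        inv_mul_lt_iff₀ hr, mul_one]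
      exact hw y hy
    intro y hy
    have hy0 : 0 < ‖y‖ := norm_pos_iff.2 hy
    have := unit (((‖y‖ : ℂ)⁻¹) • y) (by simp [norm_smul, hy])
    rw [map_smul, inner_smul_left, inner_smul_right, norm_mul, norm_mul] at this
    simp only [RCLike.norm_conj, norm_inv, Complex.norm_real, norm_norm] at this
    rw [inv_mul_lt_iff₀ hy0, inv_mul_lt_iff₀ hy0] at this
    nlinarith
  have h := norm_moebius_pow_le C hCn hαn hm v
  rw [e1, e2, smul_pow, smul_pow, LinearMap.smul_apply, LinearMap.smul_apply, norm_smul, norm_smul]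
  simp only [norm_pow, Complex.norm_real, Real.norm_of_nonneg hr.le, Real.norm_of_nonneg hκ0.le,
    mul_pow]
  have := mul_le_mul_of_nonneg_left h (mul_nonneg (pow_pos hκ0 m).le (pow_pos hρ m).le)
  linarith

end NumericalRadius

/-! ### Multiplication by `z` on the Hardy space. -/

section Shift

theorem norm_mulZ (f : H2) : ‖mulZ f‖ = ‖f‖ := by
  have h1 := lp.hasSum_norm (p := 2) (by norm_num) (mulZ f)
  simp only [ENNReal.toReal_ofNat] at h1
  have h2 : ‖mulZ f‖ ^ (2 : ℝ) = ‖f‖ ^ (2 : ℝ) := HasSum.unique h1 (hasSum_shiftSeq f)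
  exact (Real.rpow_left_inj (norm_nonneg _) (norm_nonneg _) (by norm_num)).1 h2

theorem inner_mulZ_mulZ (f g : H2) : inner ℂ (mulZ f) (mulZ g) = inner ℂ f g :=
  (LinearMap.norm_map_iff_inner_map_map mulZ).1 norm_mulZ f g

theorem mulZ_apply_zero (f : H2) : mulZ f 0 = 0 := rfl

theorem mulZ_apply_succ (f : H2) (n : ℕ) : mulZ f (n + 1) = f n := rfl

/-- The constant function `1`. -/
def oneH2 : H2 := lp.single 2 0 1

theorem inner_oneH2 (f : H2) : inner ℂ oneH2 f = f 0 := by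
  rw [oneH2, lp.inner_single_left]; simp

theorem inner_mulZ_oneH2 (f : H2) : inner ℂ (mulZ f) oneH2 = 0 := by
  rw [inner_eq_zero_symm, inner_oneH2, mulZ_apply_zero]

theorem inner_pow_mulZ_oneH2 (k : ℕ) (f : H2) : inner ℂ ((mulZ ^ k) oneH2) f = f k := by
  have : (mulZ ^ k) oneH2 = lp.single 2 k 1 := by
    induction k with
    | zero => rfl
    | succ k ih =>
      rw [pow_succ', mul_apply_eq_comp, ih]
      ext i
      cases i with
      | zero => rw [mulZ_apply_zero, lp.single_apply_ne _ _ _ (by simp)]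
      | succ i =>
        rw [mulZ_apply_succ, lp.single_apply, lp.single_apply]
        simp [Pi.single_apply]
  rw [this, lp.inner_single_left]; simp

theorem oneH2_ne_zero : oneH2 ≠ 0 := fun h => by
  have h1 : oneH2 0 = 1 := by simp [oneH2]
  rw [h] at h1
  simp at h1

theorem inner_pow_mulZ (k : ℕ) (f g : H2) :
    inner ℂ ((mulZ ^ k) f) ((mulZ ^ k) g) = inner ℂ f g := by
  induction k with
  | zero => rfl
  | succ k ih => rw [pow_succ', mul_apply_eq_comp, mul_apply_eq_comp,
      inner_mulZ_mulZ, ih]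

theorem H2.ext_eval {f g : H2} (h : ∀ z ∈ Metric.ball (0 : ℂ) 1, H2.eval f z = H2.eval g z) :
    f = g := by
  have hps : ∀ f : H2, HasFPowerSeriesAt (H2.eval f)
      (FormalMultilinearSeries.ofScalars ℂ fun n => f n) 0 := by
    intro f
    rw [hasFPowerSeriesAt_iff]
    filter_upwards [Metric.ball_mem_nhds (0 : ℂ) one_pos] with z hz
    simp only [FormalMultilinearSeries.coeff_ofScalars, zero_add, smul_eq_mul]
    simpa [mul_comm, H2.eval] using (H2.summable_eval f hz).hasSum
  have h1 : H2.eval f =ᶠ[nhds 0] H2.eval g := by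
    filter_upwards [Metric.ball_mem_nhds (0 : ℂ) one_pos] with z hz using h z hz
  have h2 := ((hps f).congr h1).eq_formalMultilinearSeries (hps g)
  ext n
  have := congrArg (fun p => p.coeff n) h2
  simpa [FormalMultilinearSeries.coeff_ofScalars] using this

open Polynomial

theorem H2.eval_aeval_mulZ (r : ℂ[X]) (f : H2) {z : ℂ} (hz : z ∈ Metric.ball (0 : ℂ) 1) :
    H2.eval (aeval mulZ r f) z = r.eval z * H2.eval f z := by
  induction r using Polynomial.induction_on' with
  | add p q hp hq =>
    rw [map_add, _root_.add_apply, H2.eval_add _ _ hz, hp, hq, Polynomial.eval_add, add_mul]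
  | monomial n a =>
    rw [aeval_monomial, eval_monomial, Algebra.algebraMap_eq_smul_one, smul_mul_assoc, one_mul,
      _root_.smul_apply, H2.eval_smul, mul_assoc]
    congr 1
    induction n with
    | zero => simp
    | succ n ih => rw [pow_succ', mul_apply_eq_comp, H2.eval_mulZ _ hz, ih]; ring

theorem aeval_mul_apply {M : Type*} [AddCommGroup M] [Module ℂ M] [TopologicalSpace M]
    [IsTopologicalAddGroup M] [ContinuousConstSMul ℂ M] (S : M →L[ℂ] M) (p q : ℂ[X]) (f : M) :
    aeval S (p * q) f = aeval S p (aeval S q f) := by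
  rw [map_mul, mul_apply_eq_comp]

theorem aeval_X_sub_C_mulZ (a : ℂ) (f : H2) : aeval mulZ (X - C a) f = mulZ f - a • f := by
  simp [Algebra.algebraMap_eq_smul_one]

theorem aeval_one_sub_C_mul_X_mulZ (a : ℂ) (f : H2) :
    aeval mulZ (1 - C a * X) f = f - a • mulZ f := by
  simp [Algebra.algebraMap_eq_smul_one]

theorem inner_mulZ_sub_smul (a : ℂ) (h u : H2) :
    inner ℂ (mulZ h - a • h) u = inner ℂ (mulZ h) (u - conj a • mulZ u) := by
  rw [inner_sub_left, inner_sub_right, inner_smul_left, inner_smul_right, inner_mulZ_mulZ]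

theorem isUnit_aeval_one_sub {a : ℂ} (ha : ‖a‖ < 1) : IsUnit (aeval mulZ (1 - C a * X)) := by
  have : aeval mulZ (1 - C a * X) = 1 - a • mulZ := by ext1 f; simp [Algebra.algebraMap_eq_smul_one]
  rw [this]
  refine isUnit_one_sub_of_norm_lt_one ?_
  rw [norm_smul]
  have h1 : ‖mulZ‖ ≤ 1 := ContinuousLinearMap.opNorm_le_bound _ zero_le_one fun f => by
    rw [norm_mulZ, one_mul]
  nlinarith [norm_nonneg a, norm_nonneg mulZ]

theorem norm_mulZ_sub_smul (a : ℂ) (u : H2) : ‖mulZ u - a • u‖ = ‖u - conj a • mulZ u‖ := by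
  rw [← sq_eq_sq₀ (norm_nonneg _) (norm_nonneg _), @norm_sub_sq ℂ, @norm_sub_sq ℂ, norm_smul,
    norm_smul, norm_mulZ, RCLike.norm_conj, inner_smul_right, inner_smul_right,
    ← inner_conj_symm (mulZ u) u]
  have : RCLike.re (a * conj (inner ℂ u (mulZ u))) = RCLike.re (conj a * inner ℂ u (mulZ u)) := by
    rw [← RCLike.conj_re, map_mul, RCLike.conj_conj]
  rw [this]

/-- Operator form of `|z - a| = |1 - conj a z|` on the unit circle; it needs only that `mulZ` is an
isometry. -/
theorem norm_aeval_pow_eq (a : ℂ) (m : ℕ) (u : H2) :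
    ‖aeval mulZ ((X - C a) ^ m) u‖ = ‖aeval mulZ ((1 - C (conj a) * X) ^ m) u‖ := by
  induction m generalizing u with
  | zero => rfl
  | succ m ih =>
    rw [pow_succ', aeval_mul_apply, aeval_X_sub_C_mulZ, norm_mulZ_sub_smul,
      ← aeval_one_sub_C_mul_X_mulZ, ← aeval_mul_apply, mul_comm, aeval_mul_apply, ih,
      ← aeval_mul_apply, ← pow_succ]

/-- Equality in Cauchy–Schwarz would make `x` an eigenvector of `mulZ`, and comparing coefficients
shows there is none. -/
theorem norm_inner_mulZ_lt {x : H2} (hx : ‖x‖ = 1) : ‖inner ℂ x (mulZ x)‖ < 1 := by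
  have hle := norm_inner_le_norm (𝕜 := ℂ) x (mulZ x)
  rw [norm_mulZ, hx, mul_one] at hle
  refine lt_of_le_of_ne hle fun h => ?_
  have hx0 : x ≠ 0 := fun h0 => by simp [h0] at hx
  have hm0 : mulZ x ≠ 0 := fun h0 => by
    rw [← norm_eq_zero, norm_mulZ, hx] at h0; exact one_ne_zero h0
  obtain ⟨r, hr, hrx⟩ := (norm_inner_eq_norm_iff (𝕜 := ℂ) hx0 hm0).1 (by rw [h, norm_mulZ, hx, mul_one])
  refine hx0 (lp.ext (funext fun n => ?_))
  have hc : ∀ n, mulZ x n = r * x n := fun n => by rw [hrx]; rfl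
  induction n with
  | zero => simpa [mulZ_apply_zero, hr] using (hc 0).symm
  | succ n ih =>
    have := hc (n + 1)
    rw [mulZ_apply_succ, ih] at this
    simpa [hr] using this.symm

end Shift

/-! ### The model space and its compressed shift. -/

section ModelSpace

open Polynomial

variable {n : ℕ} (a : Fin n → ℂ)

/-- The monic polynomial with the zeros `a j`. -/
def zeroPoly : ℂ[X] := ∏ j, (X - C (a j))

/-- The denominator of the Blaschke product with zeros `a j`. -/
def polePoly : ℂ[X] := ∏ j, (1 - C (conj (a j)) * X)

theorem isUnit_aeval_polePoly (ha : ∀ j, ‖a j‖ < 1) : IsUnit (aeval mulZ (polePoly a)) := by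
  refine Finset.prod_induction _ (fun r : ℂ[X] => IsUnit (aeval mulZ r)) (fun p q hp hq => ?_) ?_
    fun j _ => isUnit_aeval_one_sub (by simpa using ha j)
  · rw [map_mul]; exact hp.mul hq
  · simp

/-- On the circle `conj (z - a) = conj z * (1 - conj a z)`; each zero moved across the inner product
costs one factor `z` on the left. -/
theorem inner_aeval_zeroPoly (h u : H2) :
    inner ℂ (aeval mulZ (zeroPoly a) h) u
      = inner ℂ ((mulZ ^ n) h) (aeval mulZ (polePoly a) u) := by
  suffices H : ∀ (s : Finset (Fin n)) (h u : H2),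
      inner ℂ (aeval mulZ (∏ j ∈ s, (X - C (a j))) h) u
        = inner ℂ ((mulZ ^ s.card) h) (aeval mulZ (∏ j ∈ s, (1 - C (conj (a j)) * X)) u) by
    have := H Finset.univ h u
    rwa [Finset.card_fin] at this
  intro s
  induction s using Finset.induction_on with
  | empty => intro h u; simp
  | insert i s hi ih =>
    intro h u
    rw [Finset.prod_insert hi, Finset.prod_insert hi, aeval_mul_apply, aeval_X_sub_C_mulZ,
      inner_mulZ_sub_smul, ← aeval_one_sub_C_mul_X_mulZ, mul_comm (1 - _), aeval_mul_apply,
      Finset.card_insert_of_notMem hi, pow_succ, mul_apply_eq_comp, ← ih]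
    congr 1
    have := aeval_mul_apply mulZ X (∏ j ∈ s, (X - C (a j))) h
    rw [aeval_X] at this
    rw [← this, mul_comm, aeval_mul_apply, aeval_X]

theorem eval_polePoly_ne_zero (ha : ∀ j, ‖a j‖ < 1) {z : ℂ} (hz : z ∈ Metric.ball (0 : ℂ) 1) :
    (polePoly a).eval z ≠ 0 := by
  rw [polePoly, eval_prod, Finset.prod_ne_zero_iff]
  intro j _ h
  have h1 : conj (a j) * z = 1 := by simpa using (sub_eq_zero.1 (by simpa using h)).symm
  have h2 := congrArg norm h1
  rw [norm_mul, RCLike.norm_conj, norm_one] at h2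
  have := ha j
  have : ‖z‖ < 1 := by simpa using hz
  nlinarith [norm_nonneg z, norm_nonneg (a j)]

variable {a} {Θ : ℂ → ℂ} {lam : ℂ}

/-- The denominator of `Θ` is an invertible multiplier, so `Θ H²` is the range of its numerator
polynomial. -/
theorem mem_mulRange_iff (hlam : ‖lam‖ = 1) (ha : ∀ j, ‖a j‖ < 1)
    (hΘ : ∀ z ∈ Metric.ball (0 : ℂ) 1, Θ z = lam * ∏ j, (z - a j) / (1 - conj (a j) * z))
    (f : H2) : f ∈ mulRange Θ ↔ ∃ h, f = aeval mulZ (zeroPoly a) h := by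
  have hΘ' : ∀ z ∈ Metric.ball (0 : ℂ) 1,
      Θ z * (polePoly a).eval z = lam * (zeroPoly a).eval z := by
    intro z hz
    rw [hΘ z hz, Finset.prod_div_distrib]
    have := eval_polePoly_ne_zero a ha hz
    simp only [polePoly, zeroPoly, eval_prod, eval_sub, eval_one, eval_mul, eval_C, eval_X] at *
    rw [mul_assoc, div_mul_cancel₀ _ this]
  have hl0 : lam ≠ 0 := fun h => by simp [h] at hlam
  obtain ⟨e, he⟩ := isUnit_aeval_polePoly a ha
  constructor
  · rintro ⟨g, hg⟩
    obtain ⟨k, rfl⟩ : ∃ k, aeval mulZ (polePoly a) k = g :=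
      ⟨(↑e⁻¹ : H2 →L[ℂ] H2) g, by rw [← he, ← mul_apply_eq_comp, e.mul_inv]; rfl⟩
    refine ⟨lam • k, H2.ext_eval fun z hz => ?_⟩
    rw [hg z hz, H2.eval_aeval_mulZ _ _ hz, H2.eval_aeval_mulZ _ _ hz, H2.eval_smul, ← mul_assoc,
      hΘ' z hz]
    ring
  · rintro ⟨h, rfl⟩
    refine ⟨lam⁻¹ • aeval mulZ (polePoly a) h, fun z hz => ?_⟩
    rw [H2.eval_aeval_mulZ _ _ hz, H2.eval_smul, H2.eval_aeval_mulZ _ _ hz, mul_left_comm,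
      ← mul_assoc (Θ z), hΘ' z hz]
    field_simp

/-- With `v = 1 / polePoly a`, the pairing of `r v` with a multiple of `zeroPoly a` becomes that of
`r` with a multiple of `z ^ n`, which vanishes as `deg r < n`. -/
theorem aeval_mem_modelSpace (hlam : ‖lam‖ = 1) (ha : ∀ j, ‖a j‖ < 1)
    (hΘ : ∀ z ∈ Metric.ball (0 : ℂ) 1, Θ z = lam * ∏ j, (z - a j) / (1 - conj (a j) * z))
    {v : H2} (hv : aeval mulZ (polePoly a) v = oneH2) {r : ℂ[X]} (hr : r.natDegree < n) :
    aeval mulZ r v ∈ modelSpace Θ := by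
  rw [Submodule.mem_orthogonal]
  intro f hf
  obtain ⟨h, rfl⟩ := (mem_mulRange_iff hlam ha hΘ f).1 hf
  rw [inner_aeval_zeroPoly, ← aeval_mul_apply, mul_comm, aeval_mul_apply, hv,
    aeval_eq_sum_range' hr, _root_.sum_apply, inner_sum]
  refine Finset.sum_eq_zero fun k hk => ?_
  obtain ⟨l, rfl⟩ := Nat.exists_eq_add_of_lt (Finset.mem_range.1 hk)
  rw [_root_.smul_apply, inner_smul_right, add_assoc, pow_add,
    mul_apply_eq_comp, inner_pow_mulZ, pow_succ', mul_apply_eq_comp,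
    inner_mulZ_oneH2, mul_zero]

/-- The first `n` Taylor coefficients determine `f`: modulo `zeroPoly a`, whose multiples are
orthogonal to `f`, every `z ^ k` reduces to a polynomial of degree below `n`. -/
theorem finiteDimensional_modelSpace (hlam : ‖lam‖ = 1) (ha : ∀ j, ‖a j‖ < 1)
    (hΘ : ∀ z ∈ Metric.ball (0 : ℂ) 1, Θ z = lam * ∏ j, (z - a j) / (1 - conj (a j) * z)) :
    FiniteDimensional ℂ (modelSpace Θ) := by
  let ev : modelSpace Θ →ₗ[ℂ] (Fin n → ℂ) :=
    { toFun := fun f j => (f : H2) j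
      map_add' := fun f g => rfl
      map_smul' := fun c f => rfl }
  refine FiniteDimensional.of_injective ev (LinearMap.ker_eq_bot.1 (LinearMap.ker_eq_bot'.2 ?_))
  intro f hf
  have hf0 : ∀ k < n, (f : H2) k = 0 := fun k hk => congrFun hf ⟨k, hk⟩
  refine Subtype.ext (lp.ext (funext fun k => ?_))
  have hmonic : (zeroPoly a).Monic := monic_prod_X_sub_C _ _
  have hdeg : (zeroPoly a).natDegree = n := by simp [zeroPoly]
  have h1 : inner ℂ (aeval mulZ (X ^ k : ℂ[X]) oneH2) (f : H2) = 0 := by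
    rw [← modByMonic_add_div (X ^ k) (zeroPoly a), map_add, _root_.add_apply,
      inner_add_left, aeval_mul_apply, (Submodule.mem_orthogonal _ _).1 f.2 _
        ((mem_mulRange_iff hlam ha hΘ _).2 ⟨_, rfl⟩), add_zero]
    have hlt : ((X ^ k : ℂ[X]) %ₘ zeroPoly a).degree < n := by
      have := degree_modByMonic_lt (X ^ k) hmonic
      rwa [degree_eq_natDegree hmonic.ne_zero, hdeg] at this
    generalize (X ^ k : ℂ[X]) %ₘ zeroPoly a = r at hlt ⊢
    rcases eq_or_ne r 0 with rfl | hr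
    · simp
    rw [degree_eq_natDegree hr, Nat.cast_lt] at hlt
    rw [aeval_eq_sum_range' hlt, _root_.sum_apply, sum_inner]
    refine Finset.sum_eq_zero fun i hi => ?_
    rw [_root_.smul_apply, inner_smul_left, inner_pow_mulZ_oneH2, hf0 i (Finset.mem_range.1 hi),
      mul_zero]
  rw [map_pow, aeval_X, inner_pow_mulZ_oneH2] at h1
  exact h1

theorem coe_compressedShift (x : modelSpace Θ) (hx : mulZ x ∈ modelSpace Θ) :
    (compressedShift Θ x : H2) = mulZ x :=
  congrArg Subtype.val
    (Submodule.orthogonalProjectionOnto_mem_subspace_eq_self (K := modelSpace Θ) ⟨mulZ x, hx⟩)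

theorem inner_compressedShift (x : modelSpace Θ) :
    inner ℂ x (compressedShift Θ x) = inner ℂ (x : H2) (mulZ x) :=
  Submodule.inner_orthogonalProjectionOnto_eq_of_mem_left x _

theorem coe_aeval_compressedShift (v : modelSpace Θ)
    (hv : ∀ k < n, (mulZ ^ k) (v : H2) ∈ modelSpace Θ) {r : ℂ[X]} (hr : r.natDegree < n) :
    (aeval (compressedShift Θ).toLinearMap r v : H2) = aeval mulZ r (v : H2) := by
  have hpow : ∀ k < n, (((compressedShift Θ).toLinearMap ^ k) v : H2) = (mulZ ^ k) (v : H2) := by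
    intro k
    induction k with
    | zero => intro _; rfl
    | succ k ih =>
      intro hk
      have h := ih (by omega)
      rw [pow_succ', pow_succ', Module.End.mul_apply, mul_apply_eq_comp, ← h]
      refine coe_compressedShift _ ?_
      rw [h, ← mul_apply_eq_comp, ← pow_succ']
      exact hv _ hk
  rw [aeval_eq_sum_range' hr, aeval_eq_sum_range' hr, LinearMap.sum_apply, _root_.sum_apply,
    Submodule.coe_sum]
  refine Finset.sum_congr rfl fun k hk => ?_
  rw [LinearMap.smul_apply, _root_.smul_apply, Submodule.coe_smul, hpow k (Finset.mem_range.1 hk)]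

/-- A Blaschke product of degree less than `n` in the compressed shift attains its norm. -/
theorem exists_norm_pow_eq (hlam : ‖lam‖ = 1) (ha : ∀ j, ‖a j‖ < 1)
    (hΘ : ∀ z ∈ Metric.ball (0 : ℂ) 1, Θ z = lam * ∏ j, (z - a j) / (1 - conj (a j) * z))
    {z₀ : ℂ} (hz₀ : ‖z₀‖ < 1) {m : ℕ} (hm : m < n) :
    ∃ v : modelSpace Θ,
      ‖(((compressedShift Θ).toLinearMap - z₀ • 1) ^ m) v‖
        = ‖((1 - conj z₀ • (compressedShift Θ).toLinearMap) ^ m) v‖ ∧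
      ((1 - conj z₀ • (compressedShift Θ).toLinearMap) ^ m) v ≠ 0 := by
  obtain ⟨e, he⟩ := isUnit_aeval_polePoly a ha
  -- The witness is `1 / polePoly a`. Its products with `z ^ k`, `k < n`, stay in the model space,
  -- so no projection intervenes in polynomials of degree `m < n`.
  set v : H2 := (↑e⁻¹ : H2 →L[ℂ] H2) oneH2
  have hv : aeval mulZ (polePoly a) v = oneH2 := by
    rw [← he, ← mul_apply_eq_comp, e.mul_inv]; rfl
  have hmem := fun r hr => aeval_mem_modelSpace hlam ha hΘ hv (r := r) hr
  have hk : ∀ k < n, (mulZ ^ k) v ∈ modelSpace Θ := fun k hk => by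
    simpa only [map_pow, aeval_X] using hmem (X ^ k) (by simpa using hk)
  have hd1 : ((X - C z₀ : ℂ[X]) ^ m).natDegree < n := by simpa using hm
  have hd2 : ((1 - C (conj z₀) * X : ℂ[X]) ^ m).natDegree < n := by
    refine lt_of_le_of_lt (natDegree_pow_le.trans ?_) hm
    have : (1 - C (conj z₀) * X : ℂ[X]).natDegree ≤ 1 := by compute_degree
    nlinarith
  have e1 : ((compressedShift Θ).toLinearMap - z₀ • 1) ^ m
      = aeval (compressedShift Θ).toLinearMap ((X - C z₀ : ℂ[X]) ^ m) := by
    simp [Algebra.algebraMap_eq_smul_one]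
  have e2 : (1 - conj z₀ • (compressedShift Θ).toLinearMap) ^ m
      = aeval (compressedShift Θ).toLinearMap ((1 - C (conj z₀) * X : ℂ[X]) ^ m) := by
    simp [Algebra.algebraMap_eq_smul_one]
  refine ⟨⟨v, by simpa using hk 0 (by omega)⟩, ?_, fun h0 => ?_⟩
  · rw [e1, e2, Submodule.coe_norm, Submodule.coe_norm, coe_aeval_compressedShift _ hk hd1,
      coe_aeval_compressedShift _ hk hd2, norm_aeval_pow_eq]
  · rw [e2] at h0
    have h1 := congrArg Subtype.val h0
    rw [coe_aeval_compressedShift _ hk hd2] at h1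
    obtain ⟨e', he'⟩ : IsUnit (aeval mulZ ((1 - C (conj z₀) * X : ℂ[X]) ^ m)) := by
      rw [map_pow]; exact (isUnit_aeval_one_sub (by simpa using hz₀)).pow m
    have h2 : v = 0 := by
      calc v = (↑e'⁻¹ * ↑e' : H2 →L[ℂ] H2) v := by rw [e'.inv_mul]; rfl
        _ = 0 := by rw [mul_apply_eq_comp, he']; erw [h1]; exact map_zero _
    rw [h2, map_zero] at hv
    exact oneH2_ne_zero hv.symm

theorem numericalRange_subset_ball :
    numericalRange (compressedShift Θ) ⊆ Metric.ball (0 : ℂ) 1 := by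
  rintro w ⟨x, hx, rfl⟩
  rw [inner_compressedShift, mem_ball_zero_iff]
  exact norm_inner_mulZ_lt hx

theorem isCompact_numericalRange {E : Type*} [NormedAddCommGroup E] [InnerProductSpace ℂ E]
    [FiniteDimensional ℂ E] (T : E →L[ℂ] E) : IsCompact (numericalRange T) := by
  have : ProperSpace E := FiniteDimensional.proper ℂ E
  have h : numericalRange T = (fun x => inner ℂ x (T x)) '' Metric.sphere 0 1 := by
    ext w; simp [numericalRange]
  rw [h]
  exact (isCompact_sphere 0 1).image (by fun_prop)

end ModelSpace

/-! ### Degree comparison and conclusion. -/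

/-- The order of a unicritical Blaschke product is at most its degree. -/
theorem unicritical_exponent_le {B : ℂ → ℂ} {m k : ℕ} {z₀ μ : ℂ} (hB : IsFiniteBlaschke B m)
    (hz₀ : ‖z₀‖ < 1)
    (hU : ∀ z ∈ Metric.ball (0 : ℂ) 1, B z = μ * ((z - z₀) / (1 - conj z₀ * z)) ^ k) :
    k ≤ m := by
  open Polynomial in
  obtain ⟨lam, b, hlam, hb, hBz⟩ := hB
  have hball : ∀ c : ℂ, ‖c‖ < 1 → ∀ z ∈ Metric.ball (0 : ℂ) 1, 1 - conj c * z ≠ 0 := by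
    intro c hc z hz h
    have h2 := congrArg norm (sub_eq_zero.1 h)
    rw [norm_mul, RCLike.norm_conj, norm_one] at h2
    have : ‖z‖ < 1 := by simpa using hz
    nlinarith [norm_nonneg z, norm_nonneg c]
  have hpoly : C lam * zeroPoly b * (1 - C (conj z₀) * X) ^ k
      = C μ * (X - C z₀) ^ k * polePoly b := by
    refine eq_of_infinite_eval_eq _ _ (Set.Infinite.mono (s := Metric.ball (0 : ℂ) 1) ?_ ?_)
    · intro z hz
      have h := (hBz z hz).symm.trans (hU z hz)
      have h1 := eval_polePoly_ne_zero b hb hz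
      have h2 := pow_ne_zero k (hball z₀ hz₀ z hz)
      rw [Finset.prod_div_distrib, div_pow] at h
      simp only [Set.mem_ofPred_eq, polePoly, zeroPoly, eval_prod, eval_sub, eval_one, eval_mul,
        eval_C, eval_X, eval_pow] at h1 ⊢
      rw [mul_div_assoc', mul_div_assoc', div_eq_div_iff h1 h2] at h
      exact h
    · exact infinite_of_mem_nhds 0 (Metric.ball_mem_nhds 0 one_pos)
  have hz₀' : z₀ ∈ Metric.ball (0 : ℂ) 1 := by simpa using hz₀
  have hdvd : (X - C z₀) ^ k ∣ zeroPoly b := by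
    have h1 : (X - C z₀) ^ k ∣ (C lam * zeroPoly b) * (1 - C (conj z₀) * X) ^ k :=
      ⟨C μ * polePoly b, by rw [hpoly]; ring⟩
    have h2 : IsCoprime ((X - C z₀) ^ k) ((1 - C (conj z₀) * X) ^ k) := by
      -- The zero `z₀` lies inside the disk, where the denominator does not vanish; hence all `k`
      -- factors must divide `zeroPoly b`, of degree `m`.
      refine IsCoprime.pow ((irreducible_X_sub_C z₀).coprime_iff_not_dvd.2 fun h => ?_)
      rw [dvd_iff_isRoot] at h
      exact hball z₀ hz₀ z₀ hz₀' (by simpa using h)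
    have h3 := h2.dvd_of_dvd_mul_right h1
    exact (isUnit_C.2 (isUnit_iff_ne_zero.2 fun h => by simp [h] at hlam)).dvd_mul_left.1 h3
  have hne : zeroPoly b ≠ 0 := (monic_prod_X_sub_C _ _).ne_zero
  have := natDegree_le_of_dvd hdvd hne
  simpa [zeroPoly] using this

end LSC

end

theorem corollary4p2 (Θ B : ℂ → ℂ) (n m : ℕ) (z₀ : ℂ)
    (hΘ : LSC.IsFiniteBlaschke Θ n) (hB : LSC.IsFiniteBlaschke B m) (hmn : m < n)
    (hU : LSC.IsUnicritical B z₀) :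
    LSC.numericalRange (LSC.compressedShift Θ) ⊆ Metric.ball (0 : ℂ) 1 ∧
      ∃ M : ℝ, IsGreatest ((fun z => ‖B z‖) '' LSC.numericalRange (LSC.compressedShift Θ)) M ∧
        1 / 2 ≤ M := by
  have hsub := LSC.numericalRange_subset_ball (Θ := Θ)
  refine ⟨hsub, ?_⟩
  obtain ⟨lam, a, hlam, ha, hΘz⟩ := hΘ
  obtain ⟨hz₀, μ, k, hμ, hk, hBz⟩ := hU
  have hkn : k < n := (LSC.unicritical_exponent_le hB hz₀ hBz).trans_lt hmn
  have hfd := LSC.finiteDimensional_modelSpace hlam ha hΘz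
  obtain ⟨v, hv, hv0⟩ := LSC.exists_norm_pow_eq hlam ha hΘz hz₀ hkn
  have hvne : v ≠ 0 := fun h => hv0 (by rw [h, map_zero])
  have hnonempty : (LSC.numericalRange (LSC.compressedShift Θ)).Nonempty :=
    ⟨_, ((‖v‖ : ℂ)⁻¹) • v, by simp [norm_smul, hvne], rfl⟩
  have hden : ∀ z ∈ Metric.ball (0 : ℂ) 1, 1 - conj z₀ * z ≠ 0 := by
    intro z hz h
    have h2 := congrArg norm (sub_eq_zero.1 h)
    rw [norm_mul, RCLike.norm_conj, norm_one] at h2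
    have : ‖z‖ < 1 := by simpa using hz
    nlinarith [norm_nonneg z, norm_nonneg z₀]
  have hcont : ContinuousOn (fun z => ‖B z‖) (LSC.numericalRange (LSC.compressedShift Θ)) := by
    refine (ContinuousOn.congr ?_ fun z hz => hBz z (hsub hz)).norm
    exact continuousOn_const.mul (((by fun_prop : ContinuousOn (fun z => z - z₀) _).div
      (by fun_prop) fun z hz => hden z (hsub hz)).pow k)
  obtain ⟨w, hw, hmax⟩ := (LSC.isCompact_numericalRange (LSC.compressedShift Θ)).exists_isMaxOn
    hnonempty hcont
  refine ⟨‖B w‖, ⟨⟨w, hw, rfl⟩, by rintro _ ⟨z, hz, rfl⟩; exact hmax hz⟩, ?_⟩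
  by_contra! hlt
  have hnorm : ∀ z ∈ Metric.ball (0 : ℂ) 1, ‖B z‖ = (‖z - z₀‖ / ‖1 - conj z₀ * z‖) ^ k := by
    intro z hz
    rw [hBz z hz, norm_mul, hμ, one_mul, norm_pow, norm_div]
  have hk0 : k ≠ 0 := by omega
  -- The gap between the maximum and 1/2 leaves room for `c = ρ ^ k`: `c` above the maximum gives
  -- the strict disk inclusion, and `2c < 1` contradicts norm preservation at `v`.
  obtain ⟨c, hc1, hc2⟩ := exists_between hlt
  have hc0 : 0 < c := (norm_nonneg _).trans_lt hc1
  set ρ : ℝ := c ^ ((k : ℝ)⁻¹)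
  have hρ0 : 0 < ρ := Real.rpow_pos_of_pos hc0 _
  have hρk : ρ ^ k = c := Real.rpow_inv_natCast_pow hc0.le hk0
  have hρ1 : ρ < 1 := by
    rw [← pow_lt_one_iff_of_nonneg hρ0.le hk0, hρk]; linarith
  have h := LSC.norm_sub_pow_le (LSC.compressedShift Θ).toLinearMap hz₀ hρ0 hρ1
    (fun y hy => ?_) hk0 v
  · rw [hv, hρk] at h
    have : 0 < ‖((1 - conj z₀ • (LSC.compressedShift Θ).toLinearMap) ^ k) v‖ := norm_pos_iff.2 hv0
    nlinarith
  · have hz : inner ℂ y (LSC.compressedShift Θ y) ∈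
        LSC.numericalRange (LSC.compressedShift Θ) := ⟨y, hy, rfl⟩
    have h1 : ‖B _‖ ≤ ‖B w‖ := hmax hz
    rw [hnorm _ (hsub hz)] at h1
    have h2 := lt_of_pow_lt_pow_left₀ k hρ0.le ((h1.trans_lt hc1).trans_eq hρk.symm)
    rwa [div_lt_iff₀ (norm_pos_iff.2 (hden _ (hsub hz)))] at h2
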